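/- Let $d,m,n\ge 1$ be integers. For a linear map $\mathcal X$ from $d\times d$ to $d'\times d'$ complex matrices, let $\mathcal S^m_n(\mathcal X)\subseteq\mathbb R^{m\times n}$ be the set of $m$-input/$n$-output correlations achievable through $\mathcal X$ when the preparation and the measurement may share classical randomness, that is, the convex hull of the set of all $p=(p_{j|i})$ of the form $$p_{j|i}=\operatorname{Tr}[\mathcal X(\rho_i)\,\pi_j],\qquad 1\le i\le m,\ 1\le j\le n,$$ where $\rho_1,\dots,\rho_m$ are density matrices on $\mathbb C^d$ and $\{\pi_1,\dots,\pi_n\}$ is a POVM on $\mathbb C^{d'}$ ($\pi_j\ge 0$, $\sum_j\pi_j=\mathbb 1$). Let $U$ be any $d\times d$ unitary matrix and $\mathcal U_d(\rho)=U\rho U^\dagger$. Then: 1. $\mathcal S^m_n(\mathcal U_d)$ is a polytope, i.e. the convex hull of finitely many points. 2. The vertices (extreme points) of $\mathcal S^m_n(\mathcal U_d)$ are exactly the deterministic correlations using at most $d$ outputs: those $q$ with $q_{j|i}\in\{0,1\}$ for all $i,j$, with $\sum_j q_{j|i}=1$ for all $i$, and with at most $d$ values of $j$ for which $q_{j|i}\ne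 0$ for some $i$. 3. For every orthonormal basis $\{|k\rangle\}_{k=1}^d$ of $\mathbb C^d$ and every real $\lambda\le 1$ with $(d-1)\lambda\ge -1$ (in particular every $\lambda\in[0,1]$; for $d\ge 2$ these are exactly the values for which the following map is completely positive), the dephasing channel $$\mathcal F_d^\lambda(\rho)=\lambda\rho+(1-\lambda)\sum_{k}\langle k|\rho|k\rangle\,|k\rangle\langle k|$$ satisfies $\mathcal S^m_n(\mathcal F_d^\lambda)=\mathcal S^m_n(\mathcal U_d)$. -/

import Mathlib

open scoped ComplexOrder

namespace QuantumCorrelations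

/-- A density matrix (quantum state) on `ℂ^d`. -/
def IsState {d : ℕ} (ρ : Matrix (Fin d) (Fin d) ℂ) : Prop :=
  ρ.PosSemidef ∧ ρ.trace = 1

/-- A positive operator-valued measure on `ℂ^d` with `n` outcomes. -/
def IsPOVM {d n : ℕ} (E : Fin n → Matrix (Fin d) (Fin d) ℂ) : Prop :=
  (∀ j, (E j).PosSemidef) ∧ ∑ j, E j = 1

/-- The conditional probability distributions `p j|i` (written `p i j`) of the form
`Tr[X(ρ i) E j]`, for one family of `m` input states and one `n`-outcome POVM on the output. -/
def singleShotCorrelations {d d' : ℕ} (m n : ℕ)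
    (X : Matrix (Fin d) (Fin d) ℂ →ₗ[ℂ] Matrix (Fin d') (Fin d') ℂ) :
    Set (Fin m → Fin n → ℝ) :=
  {p | ∃ (ρ : Fin m → Matrix (Fin d) (Fin d) ℂ) (E : Fin n → Matrix (Fin d') (Fin d') ℂ),
    (∀ i, IsState (ρ i)) ∧ IsPOVM E ∧
      ∀ i j, (p i j : ℂ) = (X (ρ i) * E j).trace}

/-- The convex set of `m`-input/`n`-output correlations achievable through `X`: a classical
random variable shared by the preparation and the measurement is free, so that the distributions
`Tr[X(ρ i) E j]` may be mixed. -/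
def correlations {d d' : ℕ} (m n : ℕ)
    (X : Matrix (Fin d) (Fin d) ℂ →ₗ[ℂ] Matrix (Fin d') (Fin d') ℂ) :
    Set (Fin m → Fin n → ℝ) :=
  convexHull ℝ (singleShotCorrelations m n X)

/-- The unitary channel `ρ ↦ U ρ Uᴴ`. -/
def unitaryChannel {d : ℕ} (U : Matrix.unitaryGroup (Fin d) ℂ) :
    Matrix (Fin d) (Fin d) ℂ →ₗ[ℂ] Matrix (Fin d) (Fin d) ℂ where
  toFun ρ := U.1 * ρ * U.1.conjTranspose
  map_add' ρ σ := by rw [mul_add, add_mul]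
  map_smul' c ρ := by simp

/-- The rank-one operator `|v⟩⟨v|`. -/
def ketbra {d : ℕ} (v : EuclideanSpace ℂ (Fin d)) : Matrix (Fin d) (Fin d) ℂ :=
  Matrix.vecMulVec v.ofLp (star v.ofLp)

/-- The matrix element `⟨v|ρ|v⟩`. -/
def braket {d : ℕ} (v : EuclideanSpace ℂ (Fin d)) (ρ : Matrix (Fin d) (Fin d) ℂ) : ℂ :=
  dotProduct (star v.ofLp) (ρ.mulVec v.ofLp)

/-- The dephasing map `ρ ↦ t ρ + (1 - t) ∑ₖ ⟨k|ρ|k⟩ |k⟩⟨k|` in the orthonormal basis `b`. -/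
noncomputable def dephasingChannel {d : ℕ}
    (b : OrthonormalBasis (Fin d) ℂ (EuclideanSpace ℂ (Fin d))) (t : ℝ) :
    Matrix (Fin d) (Fin d) ℂ →ₗ[ℂ] Matrix (Fin d) (Fin d) ℂ where
  toFun ρ := (t : ℂ) • ρ + ((1 - t : ℝ) : ℂ) • ∑ k, braket (b k) ρ • ketbra (b k)
  map_add' ρ σ := by
    simp only [braket, Matrix.add_mulVec, dotProduct_add, add_smul, Finset.sum_add_distrib,
      smul_add]
    abel
  map_smul' c ρ := by
    simp only [braket, Matrix.smul_mulVec, dotProduct_smul, smul_eq_mul, mul_smul,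
      ← Finset.smul_sum, RingHom.id_apply, smul_add]
    rw [smul_comm c (t : ℂ) ρ, smul_comm c ((1 - t : ℝ) : ℂ)]

/-- The deterministic correlations that use at most `d` different outputs. -/
def deterministicCorrelations (d m n : ℕ) : Set (Fin m → Fin n → ℝ) :=
  {p | (∀ i j, p i j = 0 ∨ p i j = 1) ∧ (∀ i, ∑ j, p i j = 1) ∧
    {j | ∃ i, p i j ≠ 0}.ncard ≤ d}

/-- A polytope is the convex hull of finitely many points. -/
def IsPolytope {m n : ℕ} (S : Set (Fin m → Fin n → ℝ)) : Prop :=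
  ∃ V : Set (Fin m → Fin n → ℝ), V.Finite ∧ S = convexHull ℝ V

end QuantumCorrelations

/-! All three claims follow once both channels are shown to have the convex hull of
`deterministicCorrelations d m n` as correlation set (`correlations_eq_convexHull`). That set is
finite, and its 0/1 points are vertices of a cube containing the hull, hence extreme.

One inclusion needs only `d` states that stay perfectly distinguishable after the channel. The other
is `singleShot_subset_convexHull`. Expanding `det (∑ j, E j) = 1` into mixed discriminants gives a
probability distribution `P` on `d`-tuples of outcomes, depending on the POVM alone, in which the
tuples inside `R` have weight `det E_R`, where `E_R = ∑ j ∈ R, E j`. Since `0 ≤ E_R ≤ 1`, this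
determinant is at most every eigenvalue of `E_R`, hence at most `Tr (ρ E_R)`. Taking for `R` the
sublevel sets of a payoff and integrating over levels, drawing a tuple from `P` and choosing its
best entry earns at least as much as measuring. One `P` serves all inputs, so this strategy is a
mixture of deterministic correlations with at most `d` outputs, and no linear functional separates
`p` from their hull. -/

namespace QuantumCorrelations

/-! ### Mixed discriminants, layer-cake comparison and a determinant bound -/

section Auxiliary

open Finset Matrix Equiv
open scoped MatrixOrder

/-- The Andréief identity for a weighted family of vectors. -/
theorem sum_prod_mul_normSq_det {d : ℕ} {N : Type*} [Fintype N] (c : N → ℂ)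
    (v : N → Fin d → ℂ) :
    ∑ f : Fin d → N, (∏ i, c (f i)) *
        ((of fun i => v (f i)).det * star (of fun i => v (f i)).det) =
      (d.factorial : ℂ) * (∑ a, c a • vecMulVec (v a) (star (v a))).det := by
  have entry : ∀ k l, (∑ a, c a • vecMulVec (v a) (star (v a))) k l =
      ∑ a, c a * (v a k * star (v a l)) := by
    intro k l
    simp [Matrix.sum_apply, vecMulVec_apply]
  have expand : ∀ f : Fin d → N, (∏ i, c (f i)) *
      ((of fun i => v (f i)).det * star (of fun i => v (f i)).det) =
      ∑ σ : Perm (Fin d), ∑ τ : Perm (Fin d), ((Perm.sign σ : ℤ) : ℂ) *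
        (((Perm.sign τ : ℤ) : ℂ) * ∏ i, (c (f i) * (v (f i) (τ i) * star (v (f i) (σ i))))) := by
    intro f
    rw [← det_transpose (of fun i => v (f i)), det_apply', star_sum, mul_comm (∑ _, _),
      sum_mul_sum, mul_sum]
    refine sum_congr rfl fun σ _ => ?_
    rw [mul_sum]
    refine sum_congr rfl fun τ _ => ?_
    simp only [transpose_apply, of_apply, star_mul', star_prod, prod_mul_distrib, star_intCast]
    ring
  simp_rw [expand]
  rw [sum_comm]
  -- Summing over `f` turns the product into a product of matrix entries; the sum over `τ` is then
  -- the determinant with rows permuted by `σ`, and the two signs of `σ` cancel. So each `σ`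
  -- contributes equally, whence `d!`.
  have step : ∀ σ : Perm (Fin d), (∑ f : Fin d → N, ∑ τ : Perm (Fin d),
      ((Perm.sign σ : ℤ) : ℂ) * (((Perm.sign τ : ℤ) : ℂ) *
        ∏ i, (c (f i) * (v (f i) (τ i) * star (v (f i) (σ i)))))) =
      (∑ a, c a • vecMulVec (v a) (star (v a))).det := by
    intro σ
    have h := det_permute' σ (∑ a, c a • vecMulVec (v a) (star (v a)))
    rw [det_apply'] at h
    rw [sum_comm]
    have h2 : ((Perm.sign σ : ℤ) : ℂ) * ((Perm.sign σ : ℤ) : ℂ) = 1 := by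
      rw [← Int.cast_mul, Int.units_coe_mul_self, Int.cast_one]
    have h3 : (∑ a, c a • vecMulVec (v a) (star (v a))).det = ((Perm.sign σ : ℤ) : ℂ) *
        (((Perm.sign σ : ℤ) : ℂ) * (∑ a, c a • vecMulVec (v a) (star (v a))).det) := by
      rw [← mul_assoc, h2, one_mul]
    rw [h3, ← h, mul_sum]
    refine sum_congr rfl fun τ _ => ?_
    rw [← mul_sum, ← mul_sum]
    congr 2
    simp only [submatrix_apply, id_eq, entry]
    rw [prod_univ_sum, Fintype.piFinset_univ]
  simp_rw [step]
  simp [Fintype.card_perm]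

/-- The layer-cake formula for a finite weighting. -/
theorem sum_mul_sub_eq_integral {A : Type*} [Fintype A] (μ g : A → ℝ) {L M : ℝ}
    (hL : ∀ a, L ≤ g a) (hM : ∀ a, g a ≤ M) :
    MeasureTheory.IntegrableOn (fun t => ∑ a with g a < t, μ a) (Set.Ioc L M) ∧
      ∑ a, μ a * (M - g a) = ∫ t in Set.Ioc L M, ∑ a with g a < t, μ a := by
  have integrable : ∀ a, MeasureTheory.IntegrableOn
      (fun t => μ a * (Set.Ioi (g a)).indicator (1 : ℝ → ℝ) t) (Set.Ioc L M) := fun a =>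
    ((MeasureTheory.integrable_const (1 : ℝ)).indicator measurableSet_Ioi).const_mul _
  have rewrite_sum : (fun t => ∑ a with g a < t, μ a) =
      fun t => ∑ a, μ a * (Set.Ioi (g a)).indicator (1 : ℝ → ℝ) t := by
    ext t
    simp [Set.indicator_apply, sum_filter]
  rw [rewrite_sum]
  refine ⟨MeasureTheory.integrable_finsetSum _ fun a _ => integrable a, ?_⟩
  rw [MeasureTheory.integral_finsetSum _ fun a _ => integrable a]
  refine sum_congr rfl fun a _ => ?_
  rw [MeasureTheory.integral_const_mul, MeasureTheory.setIntegral_indicator measurableSet_Ioi,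
    Set.Ioc_inter_Ioi, max_eq_right (hL a)]
  simp [hM a]

/-- If two finite weightings have the same total mass and one gives less mass to all sublevel
sets, then it has the larger mean. -/
theorem sum_mul_le_sum_mul_of_sublevel_le {A B : Type*} [Fintype A] [Fintype B]
    (μ g : A → ℝ) (ν h : B → ℝ) (total : ∑ a, μ a = ∑ b, ν b)
    (H : ∀ c, ∑ a with g a < c, μ a ≤ ∑ b with h b < c, ν b) :
    ∑ b, ν b * h b ≤ ∑ a, μ a * g a := by
  obtain ⟨L₁, hL₁⟩ := (Set.finite_range g).bddBelow
  obtain ⟨L₂, hL₂⟩ := (Set.finite_range h).bddBelow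
  obtain ⟨M₁, hM₁⟩ := (Set.finite_range g).bddAbove
  obtain ⟨M₂, hM₂⟩ := (Set.finite_range h).bddAbove
  obtain ⟨ig, eg⟩ := sum_mul_sub_eq_integral μ g (L := min L₁ L₂) (M := max M₁ M₂)
    (fun a => (min_le_left _ _).trans (hL₁ ⟨a, rfl⟩))
    (fun a => (hM₁ ⟨a, rfl⟩).trans (le_max_left _ _))
  obtain ⟨ih, eh⟩ := sum_mul_sub_eq_integral ν h (L := min L₁ L₂) (M := max M₁ M₂)
    (fun a => (min_le_right _ _).trans (hL₂ ⟨a, rfl⟩))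
    (fun a => (hM₂ ⟨a, rfl⟩).trans (le_max_right _ _))
  have hint := MeasureTheory.integral_mono ig ih H
  rw [← eg, ← eh] at hint
  simp only [mul_sub, sum_sub_distrib, ← sum_mul, total] at hint
  linarith

theorem exists_eq_mul_conjTranspose {d : ℕ} {A : Matrix (Fin d) (Fin d) ℂ}
    (hA : A.PosSemidef) : ∃ B : Matrix (Fin d) (Fin d) ℂ, A = B * Bᴴ :=
  CStarAlgebra.nonneg_iff_eq_mul_star_self.mp hA.nonneg

/-- The mixed discriminants of a POVM: weights on finite families of outcomes such that the
families inside `R` have total weight `det (∑ j ∈ R, E j)`. -/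
theorem exists_weights_det {d n : ℕ} {E : Fin n → Matrix (Fin d) (Fin d) ℂ}
    (hE : ∀ j, (E j).PosSemidef) :
    ∃ P : (Fin d → Fin n × Fin d) → ℝ, (∀ f, 0 ≤ P f) ∧ ∀ R : Finset (Fin n),
      ((∑ f with ∀ k, (f k).1 ∈ R, P f : ℝ) : ℂ) = (∑ j ∈ R, E j).det := by
  choose B hB using fun j => exists_eq_mul_conjTranspose (hE j)
  -- The columns of `B j` split `E j` into `d` rank-one terms; the second index of `Fin n × Fin d`
  -- labels the column.
  set v : Fin n × Fin d → Fin d → ℂ := fun a i => B a.1 i a.2 with hv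
  refine ⟨fun f => Complex.normSq (of fun i => v (f i)).det / d.factorial,
    fun f => div_nonneg (Complex.normSq_nonneg _) (Nat.cast_nonneg _), fun R => ?_⟩
  have h := sum_prod_mul_normSq_det (fun a : Fin n × Fin d => if a.1 ∈ R then 1 else 0) v
  have hsum : ∑ a : Fin n × Fin d, (if a.1 ∈ R then (1 : ℂ) else 0) •
      vecMulVec (v a) (star (v a)) = ∑ j ∈ R, E j := by
    rw [Fintype.sum_prod_type, ← filter_univ_mem R, sum_filter]
    refine sum_congr rfl fun j _ => ?_
    split_ifs with hj
    · rw [hB j]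
      ext k l
      simp [hv, Matrix.sum_apply, vecMulVec_apply, mul_apply, hj]
    · simp [hj]
  rw [hsum] at h
  have hd : (d.factorial : ℂ) ≠ 0 := Nat.cast_ne_zero.mpr d.factorial_ne_zero
  rw [← mul_right_inj' hd, ← h, sum_filter]
  push_cast
  rw [mul_sum]
  refine sum_congr rfl fun f _ => ?_
  have hprod : (∏ i, if (f i).1 ∈ R then (1 : ℂ) else 0) =
      if ∀ k, (f k).1 ∈ R then 1 else 0 := by
    rw [prod_ite_zero]
    simp
  rw [hprod]
  split_ifs
  · rw [one_mul, Complex.star_def, Complex.mul_conj]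
    push_cast
    rw [mul_div_cancel₀ _ hd]
  · simp

/-- The determinant of an effect is a lower bound for its expectation in every state. -/
theorem det_le_trace_mul {d : ℕ} {A ρ : Matrix (Fin d) (Fin d) ℂ} (hA : A.PosSemidef)
    (hA' : (1 - A).PosSemidef) (hρ : IsState ρ) : A.det ≤ (ρ * A).trace := by
  set V : Matrix (Fin d) (Fin d) ℂ := (hA.1.eigenvectorUnitary : Matrix (Fin d) (Fin d) ℂ) with hV
  have hVV : V * Vᴴ = 1 := mem_unitaryGroup_iff.mp hA.1.eigenvectorUnitary.2
  have hVV' : Vᴴ * V = 1 := mem_unitaryGroup_iff'.mp hA.1.eigenvectorUnitary.2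
  set D : Matrix (Fin d) (Fin d) ℂ := diagonal fun i => (hA.1.eigenvalues i : ℂ) with hD
  have spec : A = V * D * Vᴴ := by
    have := hA.1.spectral_theorem
    rwa [Unitary.conjStarAlgAut_apply] at this
  have le_one : ∀ i, hA.1.eigenvalues i ≤ 1 := by
    intro i
    have h := (hA'.conjTranspose_mul_mul_same V).diag_nonneg (i := i)
    have e : Vᴴ * (1 - A) * V = 1 - D := by
      rw [spec, mul_sub, sub_mul, mul_one, hVV']
      congr 1
      rw [← mul_assoc, ← mul_assoc, hVV', one_mul, mul_assoc, hVV', mul_one]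
    rw [e] at h
    simp only [hD, Matrix.sub_apply, one_apply_eq, diagonal_apply_eq, sub_nonneg] at h
    exact_mod_cast h
  have hdet : ∀ i, A.det ≤ (hA.1.eigenvalues i : ℂ) := by
    intro i
    have : ∏ j, hA.1.eigenvalues j ≤ hA.1.eigenvalues i := by
      rw [← mul_prod_erase _ _ (mem_univ i)]
      exact mul_le_of_le_one_right (hA.eigenvalues_nonneg i)
        (prod_le_one (fun j _ => hA.eigenvalues_nonneg j) fun j _ => le_one j)
    calc A.det = ∏ j, (hA.1.eigenvalues j : ℂ) := hA.1.det_eq_prod_eigenvalues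
      _ ≤ _ := by exact_mod_cast this
  have tr : (ρ * A).trace = ∑ i, (Vᴴ * ρ * V) i i * (hA.1.eigenvalues i : ℂ) := by
    conv_lhs => rw [spec]
    rw [← mul_assoc, trace_mul_comm, ← mul_assoc, ← mul_assoc]
    simp [Matrix.trace, hD, mul_diagonal]
  have one : ∑ i, (Vᴴ * ρ * V) i i = 1 := by
    change (Vᴴ * ρ * V).trace = 1
    rw [trace_mul_comm, ← mul_assoc, hVV, one_mul, hρ.2]
  calc A.det = ∑ i, (Vᴴ * ρ * V) i i * A.det := by rw [← sum_mul, one, one_mul]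
    _ ≤ _ := by
      rw [tr]
      exact sum_le_sum fun i _ => mul_le_mul_of_nonneg_left (hdet i)
        (hρ.1.conjTranspose_mul_mul_same V).diag_nonneg

end Auxiliary

end QuantumCorrelations

namespace QuantumCorrelations
-- The Frenkel–Weiner bound and the vertices
section Main

open Finset Matrix Equiv

theorem sum_posSemidef_of_isPOVM {d n : ℕ} {E : Fin n → Matrix (Fin d) (Fin d) ℂ}
    (hE : IsPOVM E) (R : Finset (Fin n)) :
    (∑ j ∈ R, E j).PosSemidef ∧ (1 - ∑ j ∈ R, E j).PosSemidef := by
  refine ⟨posSemidef_sum _ fun j _ => hE.1 j, ?_⟩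
  rw [← hE.2, ← sum_add_sum_compl R, add_sub_cancel_left]
  exact posSemidef_sum _ fun j _ => hE.1 j

/-- For every POVM there is a distribution of families of at most `d` outcomes such that, for all
states and all payoffs, knowing the family and picking its best outcome is at least as good as
the measurement. -/
theorem exists_weights_payoff {d n : ℕ} {E : Fin n → Matrix (Fin d) (Fin d) ℂ}
    (hE : IsPOVM E) :
    ∃ P : (Fin d → Fin n × Fin d) → ℝ, (∀ f, 0 ≤ P f) ∧ ∑ f, P f = 1 ∧
      ∀ (ρ : Matrix (Fin d) (Fin d) ℂ) (q w : Fin n → ℝ) (M : (Fin d → Fin n × Fin d) → ℝ),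
        IsState ρ → (∀ j, (q j : ℂ) = (ρ * E j).trace) →
        (∀ f, ∃ k, M f = w (f k).1) → (∀ f k, w (f k).1 ≤ M f) →
        ∑ j, q j * w j ≤ ∑ f, P f * M f := by
  obtain ⟨P, hP, hdet⟩ := exists_weights_det hE.1
  have total : ∑ f, P f = 1 := by
    have h := hdet univ
    simp only [mem_univ, implies_true, filter_true, hE.2, det_one] at h
    exact_mod_cast h
  refine ⟨P, hP, total, fun ρ q w M hρ hq hM hM' => ?_⟩
  have hsum : ∀ R : Finset (Fin n), ((∑ j ∈ R, q j : ℝ) : ℂ) = (ρ * ∑ j ∈ R, E j).trace := by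
    intro R
    rw [mul_sum, trace_sum]
    push_cast
    exact sum_congr rfl fun j _ => hq j
  refine sum_mul_le_sum_mul_of_sublevel_le P M q w ?_ fun c => ?_
  · have h := hsum univ
    rw [hE.2, mul_one, hρ.2] at h
    rw [total]
    exact_mod_cast h.symm
  -- `M f` is the best payoff in the family, so `M f < c` exactly when the whole family lies in `R =
  -- {w < c}`; such families have weight `det E_R`.
  · have hR := sum_posSemidef_of_isPOVM hE (univ.filter fun j => w j < c)
    have h := det_le_trace_mul hR.1 hR.2 hρ
    rw [← hsum, ← hdet] at h
    have h' := Complex.real_le_real.mp h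
    convert h' using 2
    ext f
    obtain ⟨k, hk⟩ := hM f
    simp only [mem_filter, mem_univ, true_and]
    exact ⟨fun hf k => (hM' f k).trans_lt hf, fun hf => hk ▸ hf k⟩

theorem finite_deterministicCorrelations (d m n : ℕ) :
    (deterministicCorrelations d m n).Finite := by
  refine (Set.Finite.pi' fun _ : Fin m => Set.Finite.pi' fun _ : Fin n =>
    Set.toFinite ({0, 1} : Set ℝ)).subset fun p hp i j => ?_
  simpa using hp.1 i j

theorem deterministic_mem {d m n : ℕ} (f : Fin d → Fin n) (s : Fin m → Fin d) :
    (fun i j => if j = f (s i) then (1 : ℝ) else 0) ∈ deterministicCorrelations d m n := by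
  refine ⟨fun i j => ?_, fun i => by simp, ?_⟩
  · dsimp only
    split_ifs <;> simp
  · have hsub : {j | ∃ i, (if j = f (s i) then (1 : ℝ) else 0) ≠ 0} ⊆ Set.range f := by
      rintro j ⟨i, hi⟩
      by_cases h : j = f (s i)
      · exact ⟨s i, h.symm⟩
      · simp [h] at hi
    refine (Set.ncard_le_ncard hsub (Set.toFinite _)).trans ?_
    rw [← Set.image_univ]
    exact (Set.ncard_image_le (Set.toFinite _)).trans (by simp [Set.ncard_univ])

/-- A deterministic correlation with at most `d` outputs factors through `d` messages. -/
theorem exists_factorization_of_mem {d m n : ℕ} (hn : 0 < n) {q : Fin m → Fin n → ℝ}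
    (hq : q ∈ deterministicCorrelations d m n) :
    ∃ (s : Fin m → Fin d) (f : Fin d → Fin n), ∀ i j, q i j = if f (s i) = j then 1 else 0 := by
  obtain ⟨h01, hsum, hcard⟩ := hq
  have hex : ∀ i, ∃ j, q i j ≠ 0 := by
    intro i
    by_contra! h
    simpa [h] using hsum i
  choose g hg using hex
  have hgval : ∀ i j, q i j = if g i = j then 1 else 0 := by
    intro i j
    have h1 : q i (g i) = 1 := (h01 i (g i)).resolve_left (hg i)
    split_ifs with h
    · rw [← h, h1]
    · have hle : q i (g i) + q i j ≤ ∑ k, q i k := by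
        rw [← sum_pair h]
        exact sum_le_sum_of_subset_of_nonneg (subset_univ _) fun k _ _ => by
          rcases h01 i k with h | h <;> simp [h]
      rw [hsum, h1] at hle
      rcases h01 i j with h | h
      · exact h
      · rw [h] at hle
        norm_num at hle
  set S : Set (Fin n) := {j | ∃ i, q i j ≠ 0} with hS
  obtain ⟨e⟩ : Nonempty (S ↪ Fin d) := by
    have := Fintype.ofFinite S
    refine Function.Embedding.nonempty_of_card_le ?_
    rw [Fintype.card_fin, ← Nat.card_eq_fintype_card]
    exact hcard
  -- Messages outside the range of `e` are never sent; they decode to output `0` by default.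
  refine ⟨fun i => e ⟨g i, i, hg i⟩, Function.extend e Subtype.val fun _ => ⟨0, hn⟩,
    fun i j => ?_⟩
  rw [e.injective.extend_apply]
  exact hgval i j

/-- The bound of Frenkel and Weiner: state-preserving maps on `d × d` matrices give no more than
`d` classical messages and shared randomness. -/
theorem singleShot_subset_convexHull {d m n : ℕ}
    {X : Matrix (Fin d) (Fin d) ℂ →ₗ[ℂ] Matrix (Fin d) (Fin d) ℂ}
    (hX : ∀ ρ, IsState ρ → IsState (X ρ)) :
    singleShotCorrelations m n X ⊆ convexHull ℝ (deterministicCorrelations d m n) := by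
  rintro p ⟨ρ, E, hρ, hE, hp⟩
  by_contra hnot
  obtain ⟨φ, u, hφ, hu⟩ := geometric_hahn_banach_closed_point
    (convex_convexHull ℝ (deterministicCorrelations d m n))
    ((finite_deterministicCorrelations d m n).isClosed_convexHull ℝ) hnot
  set w : Fin m → Fin n → ℝ := fun i j => φ (Pi.single i (Pi.single j 1)) with hw
  have hφw : ∀ q : Fin m → Fin n → ℝ, φ q = ∑ i, ∑ j, q i j * w i j := by
    intro q
    have hq : q = ∑ i, ∑ j, q i j • Pi.single i (Pi.single j (1 : ℝ)) := by
      ext i j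
      simp [Finset.sum_apply, Pi.single_apply, ite_apply]
    conv_lhs => rw [hq]
    simp [hw]
  obtain ⟨P, hP, hP1, hpay⟩ := exists_weights_payoff hE
  have hmax : ∀ (f : Fin d → Fin n × Fin d) i, ∃ k, ∀ l, w i (f l).1 ≤ w i (f k).1 := by
    intro f i
    -- For `d = 0` every trace vanishes, so there are no states.
    have : Nonempty (Fin d) := by
      by_contra hempty
      rw [not_nonempty_iff] at hempty
      simpa [Matrix.trace] using (hρ i).2
    exact Finite.exists_max fun l => w i (f l).1
  choose s hs using hmax
  have hdet : ∀ f : Fin d → Fin n × Fin d, ∑ i, w i (f (s f i)).1 < u := by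
    intro f
    have h := hφ _ (subset_convexHull ℝ _ (deterministic_mem (fun k => (f k).1) (s f)))
    simpa [hφw] using h
  have hle : φ p ≤ ∑ f, P f * ∑ i, w i (f (s f i)).1 := by
    simp_rw [hφw, mul_sum]
    rw [sum_comm (s := univ (α := Fin d → Fin n × Fin d))]
    exact sum_le_sum fun i _ => hpay (X (ρ i)) (p i) (w i) (fun f => w i (f (s f i)).1)
      (hX _ (hρ i)) (hp i) (fun f => ⟨s f i, rfl⟩) fun f k => hs f i k
  have hlt : ∑ f, P f * ∑ i, w i (f (s f i)).1 ≤ ∑ f, P f * u :=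
    sum_le_sum fun f _ => mul_le_mul_of_nonneg_left (hdet f).le (hP f)
  rw [← sum_mul, hP1, one_mul] at hlt
  linarith

/-- With `d` perfectly distinguishable states all deterministic correlations with at most `d`
outputs can be achieved. -/
theorem deterministic_subset_singleShot {d m n : ℕ} (hn : 0 < n)
    {X : Matrix (Fin d) (Fin d) ℂ →ₗ[ℂ] Matrix (Fin d) (Fin d) ℂ}
    {σ e : Fin d → Matrix (Fin d) (Fin d) ℂ} (hσ : ∀ k, IsState (σ k)) (he : IsPOVM e)
    (hX : ∀ k l, (X (σ k) * e l).trace = if k = l then 1 else 0) :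
    deterministicCorrelations d m n ⊆ singleShotCorrelations m n X := by
  intro q hq
  obtain ⟨s, f, hsf⟩ := exists_factorization_of_mem hn hq
  -- Input `i` sends the state of message `s i`; decoding by `f` is a coarse-graining of the POVM
  -- `e`.
  refine ⟨fun i => σ (s i), fun j => ∑ k with f k = j, e k, fun i => hσ _,
    ⟨fun j => posSemidef_sum _ fun k _ => he.1 k, ?_⟩, fun i j => ?_⟩
  · rw [sum_fiberwise, he.2]
  · rw [mul_sum, trace_sum, hsf]
    simp only [hX, sum_ite_eq, mem_filter, mem_univ, true_and]
    split_ifs <;> simp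

theorem correlations_eq_convexHull {d m n : ℕ} (hn : 0 < n)
    {X : Matrix (Fin d) (Fin d) ℂ →ₗ[ℂ] Matrix (Fin d) (Fin d) ℂ}
    {σ e : Fin d → Matrix (Fin d) (Fin d) ℂ} (hX : ∀ ρ, IsState ρ → IsState (X ρ))
    (hσ : ∀ k, IsState (σ k)) (he : IsPOVM e)
    (hXσ : ∀ k l, (X (σ k) * e l).trace = if k = l then 1 else 0) :
    correlations m n X = convexHull ℝ (deterministicCorrelations d m n) :=
  (convexHull_min (singleShot_subset_convexHull hX) (convex_convexHull ℝ _)).antisymm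
    (convexHull_mono (deterministic_subset_singleShot hn hσ he hXσ))

theorem extremePoints_convexHull_deterministic (d m n : ℕ) :
    (convexHull ℝ (deterministicCorrelations d m n)).extremePoints ℝ =
      deterministicCorrelations d m n := by
  refine extremePoints_convexHull_subset.antisymm fun q hq => ?_
  set C : Set (Fin m → Fin n → ℝ) :=
    Set.univ.pi fun _ => Set.univ.pi fun _ => Set.Icc (0 : ℝ) 1 with hC
  have hsub : convexHull ℝ (deterministicCorrelations d m n) ⊆ C := by
    refine convexHull_min (fun p hp i _ j _ => ?_)
      (convex_pi fun _ _ => convex_pi fun _ _ => convex_Icc 0 1)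
    rcases hp.1 i j with h | h <;> simp [h]
  refine inter_extremePoints_subset_extremePoints_of_subset hsub
    ⟨subset_convexHull ℝ _ hq, ?_⟩
  simp only [hC, extremePoints_pi, Set.extremePoints_Icc zero_le_one]
  intro i _ j _
  simpa using hq.1 i j

end Main
end QuantumCorrelations

namespace QuantumCorrelations
-- Unitary and dephasing channels
section Channels

open Finset Matrix

theorem isState_single {d : ℕ} (k : Fin d) : IsState (single k k (1 : ℂ)) := by
  refine ⟨?_, by simp⟩
  rw [← diagonal_single]
  exact PosSemidef.diagonal (Pi.single_nonneg.mpr zero_le_one)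

theorem isPOVM_single (d : ℕ) : IsPOVM fun k : Fin d => single k k (1 : ℂ) :=
  ⟨fun k => (isState_single k).1, by simp [Matrix.sum_single_one]⟩

theorem trace_single_mul_single {d : ℕ} (k l : Fin d) :
    (single k k (1 : ℂ) * single l l 1).trace = if k = l then 1 else 0 := by
  split_ifs with h
  · subst h
    simp
  · rw [single_mul_single_of_ne _ _ _ _ h, trace_zero]

theorem isState_unitary_conj {d : ℕ} {V : Matrix (Fin d) (Fin d) ℂ} (hV : Vᴴ * V = 1)
    {ρ : Matrix (Fin d) (Fin d) ℂ} (hρ : IsState ρ) : IsState (V * ρ * Vᴴ) :=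
  ⟨hρ.1.mul_mul_conjTranspose_same V, by rw [trace_mul_cycle, hV, one_mul, hρ.2]⟩

theorem correlations_unitaryChannel {d m n : ℕ} (hn : 0 < n) (U : unitaryGroup (Fin d) ℂ) :
    correlations m n (unitaryChannel U) = convexHull ℝ (deterministicCorrelations d m n) := by
  have h₁ : U.1ᴴ * U.1 = 1 := mem_unitaryGroup_iff'.mp U.2
  have h₂ : U.1 * U.1ᴴ = 1 := mem_unitaryGroup_iff.mp U.2
  refine correlations_eq_convexHull hn (fun ρ hρ => isState_unitary_conj h₁ hρ)
    -- The standard basis states are pulled back through `U`, so that the channel outputs exactly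
    -- them.
    (σ := fun k => U.1ᴴ * single k k 1 * U.1ᴴᴴ)
    (fun k => isState_unitary_conj (by rwa [conjTranspose_conjTranspose]) (isState_single k))
    (isPOVM_single d) fun k l => ?_
  change (U.1 * (U.1ᴴ * single k k 1 * U.1ᴴᴴ) * U.1ᴴ * single l l 1).trace = _
  have : U.1 * (U.1ᴴ * single k k 1 * U.1ᴴᴴ) * U.1ᴴ = single k k 1 := by
    rw [conjTranspose_conjTranspose, ← mul_assoc, ← mul_assoc, h₂, one_mul, mul_assoc, h₂,
      mul_one]
  rw [this, trace_single_mul_single]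

theorem trace_mul_ketbra {d : ℕ} (ρ : Matrix (Fin d) (Fin d) ℂ)
    (v : EuclideanSpace ℂ (Fin d)) : (ρ * ketbra v).trace = braket v ρ := by
  rw [ketbra, braket, mul_vecMulVec, trace_vecMulVec, dotProduct_comm]

theorem ketbra_mul_mul_ketbra {d : ℕ} (ρ : Matrix (Fin d) (Fin d) ℂ)
    (v : EuclideanSpace ℂ (Fin d)) : ketbra v * ρ * ketbra v = braket v ρ • ketbra v := by
  rw [ketbra, braket, mul_assoc, mul_vecMulVec, vecMulVec_mul_vecMulVec, vecMulVec_smul]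

theorem conjTranspose_ketbra {d : ℕ} (v : EuclideanSpace ℂ (Fin d)) :
    (ketbra v)ᴴ = ketbra v := by
  simp [ketbra, conjTranspose_vecMulVec]

theorem posSemidef_ketbra {d : ℕ} (v : EuclideanSpace ℂ (Fin d)) : (ketbra v).PosSemidef :=
  posSemidef_vecMulVec_self_star _

variable {d : ℕ} (b : OrthonormalBasis (Fin d) ℂ (EuclideanSpace ℂ (Fin d)))

theorem dotProduct_basis (k l : Fin d) :
    star (b k).ofLp ⬝ᵥ (b l).ofLp = if k = l then 1 else 0 := by
  rw [← orthonormal_iff_ite.mp b.orthonormal k l, EuclideanSpace.inner_eq_star_dotProduct,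
    dotProduct_comm]

theorem braket_ketbra (k l : Fin d) : braket (b l) (ketbra (b k)) = if k = l then 1 else 0 := by
  rw [← trace_mul_ketbra, ketbra, ketbra, vecMulVec_mul_vecMulVec, vecMulVec_smul, trace_smul,
    trace_vecMulVec, dotProduct_comm (b k).ofLp, dotProduct_basis, dotProduct_basis]
  by_cases h : k = l
  · simp [h]
  · simp [h]

theorem isState_ketbra (k : Fin d) : IsState (ketbra (b k)) := by
  refine ⟨posSemidef_ketbra _, ?_⟩
  rw [ketbra, trace_vecMulVec, dotProduct_comm, dotProduct_basis, if_pos rfl]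

theorem sum_ketbra : ∑ k, ketbra (b k) = 1 := by
  set B : Matrix (Fin d) (Fin d) ℂ := of fun i k => (b k).ofLp i with hB
  -- Orthonormality is `Bᴴ * B = 1`; completeness is `B * Bᴴ = 1`, equivalent for square matrices.
  have h : Bᴴ * B = 1 := by
    ext k l
    rw [one_apply, ← dotProduct_basis b k l]
    simp [mul_apply, dotProduct, hB]
  rw [← mul_eq_one_comm.mp h]
  ext i j
  simp [Matrix.sum_apply, ketbra, vecMulVec_apply, mul_apply, hB]

theorem isPOVM_ketbra : IsPOVM fun k => ketbra (b k) :=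
  ⟨fun _ => posSemidef_ketbra _, sum_ketbra b⟩

theorem dephasingChannel_apply (t : ℝ) (ρ : Matrix (Fin d) (Fin d) ℂ) :
    dephasingChannel b t ρ =
      (t : ℂ) • ρ + ((1 - t : ℝ) : ℂ) • ∑ k, braket (b k) ρ • ketbra (b k) :=
  rfl

theorem dephasingChannel_ketbra (t : ℝ) (k : Fin d) :
    dephasingChannel b t (ketbra (b k)) = ketbra (b k) := by
  simp only [dephasingChannel_apply, braket_ketbra, ite_smul, one_smul, zero_smul, sum_ite_eq,
    mem_univ, if_true]
  rw [← add_smul, ← Complex.ofReal_add, add_sub_cancel, Complex.ofReal_one, one_smul]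

theorem trace_dephasingChannel (t : ℝ) (ρ : Matrix (Fin d) (Fin d) ℂ) :
    (dephasingChannel b t ρ).trace = ρ.trace := by
  have h : ∑ k, braket (b k) ρ = ρ.trace := by
    simp_rw [← trace_mul_ketbra]
    rw [← trace_sum, ← mul_sum, sum_ketbra, mul_one]
  have h' : ∀ k, (ketbra (b k)).trace = 1 := fun k => (isState_ketbra b k).2
  simp only [dephasingChannel_apply, trace_add, trace_smul, trace_sum, h', smul_eq_mul, mul_one, h]
  push_cast
  ring

/-- The differences of the basis projections give a Kraus form of the pinching inequality. -/
theorem sum_sub_mul_mul_sub (ρ : Matrix (Fin d) (Fin d) ℂ) :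
    ∑ k, ∑ l, (ketbra (b k) - ketbra (b l)) * ρ * (ketbra (b k) - ketbra (b l))ᴴ =
      (2 * d : ℂ) • ∑ k, braket (b k) ρ • ketbra (b k) - (2 : ℂ) • ρ := by
  have h : ∀ k l, (ketbra (b k) - ketbra (b l)) * ρ * (ketbra (b k) - ketbra (b l))ᴴ =
      braket (b k) ρ • ketbra (b k) + braket (b l) ρ • ketbra (b l)
        - ketbra (b k) * ρ * ketbra (b l) - ketbra (b l) * ρ * ketbra (b k) := by
    intro k l
    rw [conjTranspose_sub, conjTranspose_ketbra, conjTranspose_ketbra,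
      ← ketbra_mul_mul_ketbra, ← ketbra_mul_mul_ketbra]
    noncomm_ring
  have h₁ : ∑ k, ∑ l, ketbra (b k) * ρ * ketbra (b l) = ρ := by
    simp_rw [← mul_sum, ← sum_mul, sum_ketbra, one_mul, mul_one]
  have h₂ : ∑ k, ∑ l, ketbra (b l) * ρ * ketbra (b k) = ρ := by
    rw [sum_comm, h₁]
  simp only [h, sum_sub_distrib, sum_add_distrib, h₁, h₂, sum_const, card_univ, Fintype.card_fin,
    ← smul_sum]
  module

/-- Positivity for negative `t` comes from the pinching inequality: the channel is a nonnegative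
combination of the identity and the Kraus sum in `sum_sub_mul_mul_sub`. -/
theorem isState_dephasingChannel {t : ℝ} (ht : -1 ≤ ((d : ℝ) - 1) * t) (ht' : t ≤ 1)
    {ρ : Matrix (Fin d) (Fin d) ℂ} (hρ : IsState ρ) : IsState (dephasingChannel b t ρ) := by
  refine ⟨?_, by rw [trace_dephasingChannel, hρ.2]⟩
  have hd : (d : ℝ) ≠ 0 := by
    rintro h
    obtain rfl : d = 0 := by exact_mod_cast h
    simpa [Matrix.trace] using hρ.2
  have hd' : (d : ℂ) ≠ 0 := by exact_mod_cast hd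
  have hα : 0 ≤ (((d - 1) * t + 1) / d : ℝ) := div_nonneg (by linarith) (Nat.cast_nonneg _)
  have hβ : 0 ≤ ((1 - t) / (2 * d) : ℝ) := div_nonneg (by linarith) (by positivity)
  -- The coefficients `α`, `β` solve `2 d β = 1 - t` and `α - 2 β = t`; the two bounds on `t` say
  -- exactly that `α` and `β` are nonnegative.
  have key : dephasingChannel b t ρ = ((((d - 1) * t + 1) / d : ℝ) : ℂ) • ρ +
      (((1 - t) / (2 * d) : ℝ) : ℂ) •
        ∑ k, ∑ l, (ketbra (b k) - ketbra (b l)) * ρ * (ketbra (b k) - ketbra (b l))ᴴ := by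
    rw [sum_sub_mul_mul_sub, dephasingChannel_apply, smul_sub, smul_smul, smul_smul,
      add_sub_left_comm, ← sub_smul, add_comm]
    congr 2
    · push_cast
      field_simp
    · push_cast
      field_simp
      ring
  rw [key]
  exact (hρ.1.smul (by exact_mod_cast hα)).add
    ((posSemidef_sum _ fun k _ => posSemidef_sum _ fun l _ =>
      hρ.1.mul_mul_conjTranspose_same _).smul (by exact_mod_cast hβ))

theorem correlations_dephasingChannel {m n : ℕ} (hn : 0 < n) {t : ℝ}
    (ht : -1 ≤ ((d : ℝ) - 1) * t) (ht' : t ≤ 1) :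
    correlations m n (dephasingChannel b t) =
      convexHull ℝ (deterministicCorrelations d m n) :=
  correlations_eq_convexHull hn (fun _ => isState_dephasingChannel b ht ht') (isState_ketbra b)
    (isPOVM_ketbra b) fun k l => by
      rw [dephasingChannel_ketbra, trace_mul_ketbra, braket_ketbra]

end Channels
end QuantumCorrelations

theorem mainTheorem10 (d m n : ℕ) (hn : 0 < n) (U : Matrix.unitaryGroup (Fin d) ℂ) :
    QuantumCorrelations.IsPolytope
      (QuantumCorrelations.correlations m n (QuantumCorrelations.unitaryChannel U)) ∧
    Set.extremePoints ℝ
      (QuantumCorrelations.correlations m n (QuantumCorrelations.unitaryChannel U)) =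
      QuantumCorrelations.deterministicCorrelations d m n ∧
    ∀ (b : OrthonormalBasis (Fin d) ℂ (EuclideanSpace ℂ (Fin d))) (t : ℝ),
      -1 ≤ ((d : ℝ) - 1) * t → t ≤ 1 →
      QuantumCorrelations.correlations m n (QuantumCorrelations.unitaryChannel U) =
        QuantumCorrelations.correlations m n (QuantumCorrelations.dephasingChannel b t) := by
  rw [QuantumCorrelations.correlations_unitaryChannel hn U]
  exact ⟨⟨_, QuantumCorrelations.finite_deterministicCorrelations d m n, rfl⟩,
    QuantumCorrelations.extremePoints_convexHull_deterministic d m n,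
    fun b t ht ht' => (QuantumCorrelations.correlations_dephasingChannel b hn ht ht').symm⟩
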